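/- **Setting.** All manifolds are $C^\infty$, Hausdorff and without boundary, all vector fields are $C^\infty$, and $\nabla$ denotes the Levi-Civita connection of $(M,g_M)$. A *cosymplectic manifold* $M(\phi,\xi,\eta,g_M)$ is a Riemannian manifold $(M,g_M)$ with a smooth $(1,1)$-tensor field $\phi$, a smooth vector field $\xi$ and a smooth $1$-form $\eta$ such that $$\phi^2=-I+\eta\otimes\xi,\quad \phi\xi=0,\quad \eta\circ\phi=0,\quad \eta(\xi)=1,\quad g_M(\phi X,\phi Y)=g_M(X,Y)-\eta(X)\eta(Y),\quad \eta(X)=g_M(X,\xi),$$ which is normal, i.e. $[\phi,\phi]+2\,d\eta\otimes\xi=0$ with $[\phi,\phi]$ the Nijenhuis tensor of $\phi$ and $2\,d\eta(X,Y)=X\eta(Y)-Y\eta(X)-\eta([X,Y])$, and for which the forms $\eta$ and $\Phi(X,Y)=g_M(X,\phi Y)$ are closed. A *Riemannian submersion* $F:(M,g_M)\to(N,g_N)$ is a smooth surjective map between Riemannian manifolds whose differential $F_*$ is surjective at every point and preserves the lengths of horizontal vectors, i.e. of the vectors in $(\ker F_*)^\perp$. The vectors in $\ker F_*$ are called vertical,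 and $\mathcal V,\mathcal H$ denote the orthogonal projections onto $\ker F_*$ and $(\ker F_*)^\perp$. $F$ is *anti-invariant* if $\phi(\ker F_*)\subseteq(\ker F_*)^\perp$. For horizontal $X$ write $\phi X=BX+CX$ with $BX$ vertical and $CX$ horizontal. Let $$\mathcal A_EG=\mathcal V\nabla_{\mathcal HE}\mathcal HG+\mathcal H\nabla_{\mathcal HE}\mathcal VG,\qquad (\nabla F_*)(E,G)=\nabla^F_E F_*G-F_*(\nabla_EG)$$ be O'Neill's tensor and the second fundamental form of $F$, where $\nabla^F$ is the pullback along $F$ of the Levi-Civita connection of $N$. The distribution $(\ker F_*)^\perp$ is *integrable* if $[X,Y]$ is horizontal for all horizontal vector fields $X,Y$. **Theorem 3.** Let $F$ be an anti-invariant Riemannian submersion from a cosymplectic manifold $M(\phi,\xi,\eta,g_M)$ to a Riemannian manifold $(N,g_N)$ such that $\xi$ is vertical. Then the following assertions are equivalent: (i) $(\ker F_*)^\perp$ is integrable; (ii) for all horizontal vector fields $X,Y$ and all vertical vector fields $V$, $$g_N\big((\nabla F_*)(Y,BX),F_*\phi V\big)=g_N\big((\nabla F_*)(X,BY),F_*\phi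 V\big)+g_M(CY,\phi\mathcal A_XV)-g_M(CX,\phi\mathcal A_YV);$$ (iii) for all horizontal vector fields $X,Y$ and all vertical vector fields $V$, $$g_M(\mathcal A_XBY-\mathcal A_YBX,\phi V)=g_M(CY,\phi\mathcal A_XV)-g_M(CX,\phi\mathcal A_YV).$$ -/

import Mathlib

open Bundle Manifold VectorField Module
open scoped ContDiff

set_option linter.unusedSectionVars false

noncomputable section

namespace RiemSubm
variable {E : Type*} [NormedAddCommGroup E] [NormedSpace ℝ E] [FiniteDimensional ℝ E]
  {H : Type*} [TopologicalSpace H] {I : ModelWithCorners ℝ E H}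
  {M : Type*} [TopologicalSpace M] [ChartedSpace H M] [IsManifold I ∞ M]
  [RiemannianBundle (fun x : M ↦ TangentSpace I x)]
  [IsContMDiffRiemannianBundle I ∞ E (fun x : M ↦ TangentSpace I x)]

/-- The tangent spaces are finite dimensional. -/
instance finiteDimensional_tangentSpace (x : M) : FiniteDimensional ℝ (TangentSpace I x) :=
  inferInstanceAs (FiniteDimensional ℝ E)

/-- The right-hand side of the Koszul formula for `⟪∇_X Y, Z⟫` at `x`. -/
def koszul (X Y Z : Π x : M, TangentSpace I x) (x : M) : ℝ :=
  (1 / 2 : ℝ) * (mvfderiv I (fun y ↦ inner ℝ (Y y) (Z y)) x (X x)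
    + mvfderiv I (fun y ↦ inner ℝ (X y) (Z y)) x (Y x)
    - mvfderiv I (fun y ↦ inner ℝ (X y) (Y y)) x (Z x)
    + inner ℝ (mlieBracket I X Y x) (Z x)
    - inner ℝ (mlieBracket I X Z x) (Y x)
    - inner ℝ (mlieBracket I Y Z x) (X x))

theorem mdiff_inner {X Y : Π x : M, TangentSpace I x} {x : M}
    (hX : MDiffAt (T% X) x) (hY : MDiffAt (T% Y) x) :
    MDiffAt (fun y ↦ inner ℝ (X y) (Y y)) x :=
  MDifferentiableAt.inner_bundle (F := E) (E := fun x : M ↦ TangentSpace I x) (b := id) hX hY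

theorem koszul_tensorial_left {x : M} {Y Z : Π x : M, TangentSpace I x}
    (hY : MDiffAt (T% Y) x) (hZ : MDiffAt (T% Z) x) :
    TensorialAt I E (fun X ↦ koszul X Y Z x) x where
  smul {f X} hf hX := by
    have h1 := mvfderiv_fun_mul hf (mdiff_inner hX hZ)
    have h2 := mvfderiv_fun_mul hf (mdiff_inner hX hY)
    simp only [koszul, Pi.smul_apply', real_inner_smul_left, h1, h2,
      mlieBracket_smul_left hf hX, inner_add_left, real_inner_smul_right]
    simp
    rw [real_inner_comm (Y x) (X x), real_inner_comm (Z x) (X x)]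
    ring
  add {X X'} hX hX' := by
    have h1 := mvfderiv_fun_add (mdiff_inner hX hZ) (mdiff_inner hX' hZ)
    have h2 := mvfderiv_fun_add (mdiff_inner hX hY) (mdiff_inner hX' hY)
    simp only [koszul, Pi.add_apply, inner_add_left, h1, h2, mlieBracket_add_left hX hX',
      inner_add_right]
    simp
    ring

theorem koszul_tensorial_right {x : M} {X Y : Π x : M, TangentSpace I x}
    (hX : MDiffAt (T% X) x) (hY : MDiffAt (T% Y) x) :
    TensorialAt I E (fun Z ↦ koszul X Y Z x) x where
  smul {f Z} hf hZ := by
    have h1 := mvfderiv_fun_mul hf (mdiff_inner hX hZ)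
    have h2 := mvfderiv_fun_mul hf (mdiff_inner hY hZ)
    simp only [koszul, Pi.smul_apply', real_inner_smul_right, h1, h2,
      mlieBracket_smul_right hf hZ, inner_add_left, real_inner_smul_left]
    simp
    rw [real_inner_comm (Y x) (Z x), real_inner_comm (X x) (Z x)]
    ring
  add {Z Z'} hZ hZ' := by
    have h1 := mvfderiv_fun_add (mdiff_inner hX hZ) (mdiff_inner hX hZ')
    have h2 := mvfderiv_fun_add (mdiff_inner hY hZ) (mdiff_inner hY hZ')
    simp only [koszul, Pi.add_apply, inner_add_left, h1, h2, mlieBracket_add_right hZ hZ',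
      inner_add_right]
    simp
    ring

/-- For a field `Y` differentiable at `x`, the Koszul expression as a bilinear form on `T_x M` in the
values at `x` of the outer two arguments. -/
def koszulForm (Y : Π x : M, TangentSpace I x) (x : M) (hY : MDiffAt (T% Y) x) :
    TangentSpace I x →L[ℝ] TangentSpace I x →L[ℝ] ℝ :=
  TensorialAt.mkHom₂ (I := I) (F := E) (F' := E) (fun X Z ↦ koszul X Y Z x) x
    (fun _ hZ ↦ koszul_tensorial_left hY hZ) (fun _ hX ↦ koszul_tensorial_right hX hY)

theorem koszulForm_apply {X Y Z : Π x : M, TangentSpace I x} {x : M} (hX : MDiffAt (T% X) x)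
    (hY : MDiffAt (T% Y) x) (hZ : MDiffAt (T% Z) x) :
    koszulForm Y x hY (X x) (Z x) = koszul X Y Z x :=
  TensorialAt.mkHom₂_apply _ _ hX hZ

/-- The endomorphism of `T_x M` that represents a bilinear form: `⟪sharp x B v, w⟫ = B v w`. -/
def sharp (x : M) (B : TangentSpace I x →L[ℝ] TangentSpace I x →L[ℝ] ℝ) :
    TangentSpace I x →L[ℝ] TangentSpace I x :=
  LinearMap.toContinuousLinearMap
    { toFun := fun v ↦ (InnerProductSpace.toDual ℝ (TangentSpace I x)).symm (B v)
      map_add' := fun v w ↦ by simp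
      map_smul' := fun c v ↦ by simp }

theorem inner_sharp (x : M) (B : TangentSpace I x →L[ℝ] TangentSpace I x →L[ℝ] ℝ)
    (v w : TangentSpace I x) : inner ℝ (sharp x B v) w = B v w := by
  simp [sharp]

open Classical in
/-- `∇ Y` at `x` as the endomorphism `v ↦ ∇_v Y`, obtained from the Koszul formula
(with value `0` where the field `Y` is not differentiable). -/
def leviCivitaFun (Y : Π x : M, TangentSpace I x) (x : M) :
    TangentSpace I x →L[ℝ] TangentSpace I x :=
  if hY : MDiffAt (T% Y) x then sharp x (koszulForm Y x hY) else 0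

theorem inner_leviCivitaFun {X Y Z : Π x : M, TangentSpace I x} {x : M} (hX : MDiffAt (T% X) x)
    (hY : MDiffAt (T% Y) x) (hZ : MDiffAt (T% Z) x) :
    inner ℝ (leviCivitaFun Y x (X x)) (Z x) = koszul X Y Z x := by
  rw [leviCivitaFun, dif_pos hY, inner_sharp, koszulForm_apply hX hY hZ]

theorem ext_of_fields {x : M} {A B : TangentSpace I x →L[ℝ] TangentSpace I x}
    (h : ∀ X Z : Π x : M, TangentSpace I x, MDiffAt (T% X) x → MDiffAt (T% Z) x →
      inner ℝ (A (X x)) (Z x) = inner ℝ (B (X x)) (Z x)) : A = B := by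
  ext v
  refine ext_inner_right ℝ fun w ↦ ?_
  simpa using h (FiberBundle.extend E v) (FiberBundle.extend E w)
    (FiberBundle.mdifferentiableAt_extend ..) (FiberBundle.mdifferentiableAt_extend ..)

variable (I M) in
/-- The Levi-Civita connection of a Riemannian manifold. `leviCivita I M Y x (X x)` is
`(∇_X Y)(x)`. -/
def leviCivita : CovariantDerivative I E (fun x : M ↦ TangentSpace I x) where
  toFun := leviCivitaFun
  isCovariantDerivativeOnUniv :=
    { add := fun {Y Y' x} hY hY' _ ↦ ext_of_fields fun X Z hX hZ ↦ by
        rw [inner_leviCivitaFun hX (mdifferentiableAt_add_section hY hY') hZ,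
          add_apply, inner_add_left,
          inner_leviCivitaFun hX hY hZ, inner_leviCivitaFun hX hY' hZ]
        have h1 := mvfderiv_fun_add (mdiff_inner hX hY) (mdiff_inner hX hY')
        have h2 := mvfderiv_fun_add (mdiff_inner hY hZ) (mdiff_inner hY' hZ)
        simp only [koszul, Pi.add_apply, inner_add_left, h1, h2, mlieBracket_add_right hY hY',
          mlieBracket_add_left hY hY', inner_add_right]
        simp
        ring
      leibniz := fun {Y f x} hY hf _ ↦ ext_of_fields fun X Z hX hZ ↦ by
        rw [inner_leviCivitaFun hX (hf.smul_section hY) hZ,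
          add_apply, inner_add_left, smul_apply,
          real_inner_smul_left,
          inner_leviCivitaFun hX hY hZ]
        have h1 := mvfderiv_fun_mul hf (mdiff_inner hX hY)
        have h2 := mvfderiv_fun_mul hf (mdiff_inner hY hZ)
        simp only [koszul, Pi.smul_apply', inner_add_left, real_inner_smul_left,
          real_inner_smul_right, h1, h2, mlieBracket_smul_right hf hY,
          mlieBracket_smul_left hf hY]
        simp [real_inner_smul_left]
        rw [real_inner_comm (X x) (Y x)]
        ring }

/-- The Levi-Civita connection is torsion free. -/
theorem leviCivita_torsion : (leviCivita I M).torsion = 0 := by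
  rw [CovariantDerivative.torsion_eq_zero_iff]
  intro X Y x hX hY
  refine ext_inner_right ℝ fun w ↦ ?_
  have hZ : MDiffAt (T% (FiberBundle.extend E w : Π x : M, TangentSpace I x)) x :=
    FiberBundle.mdifferentiableAt_extend ..
  have h1 := inner_leviCivitaFun hX hY hZ
  have h2 := inner_leviCivitaFun hY hX hZ
  simp only [FiberBundle.extend_apply_self] at h1 h2
  change inner ℝ (leviCivitaFun Y x (X x) - leviCivitaFun X x (Y x)) w = _
  rw [inner_sub_left, h1, h2]
  simp only [koszul]
  rw [mlieBracket_swap_apply (V := Y) (W := X)]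
  simp only [inner_neg_left, real_inner_comm, FiberBundle.extend_apply_self]
  ring

/-- The Levi-Civita connection is compatible with the metric. -/
theorem leviCivita_metric {X Y Z : Π x : M, TangentSpace I x} {x : M} (hX : MDiffAt (T% X) x)
    (hY : MDiffAt (T% Y) x) (hZ : MDiffAt (T% Z) x) :
    mvfderiv I (fun y ↦ inner ℝ (Y y) (Z y)) x (X x) =
      inner ℝ (leviCivita I M Y x (X x)) (Z x) + inner ℝ (Y x) (leviCivita I M Z x (X x)) := by
  have h1 := inner_leviCivitaFun hX hY hZ
  have h2 := inner_leviCivitaFun hX hZ hY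
  change _ = inner ℝ (leviCivitaFun Y x (X x)) (Z x) + inner ℝ (Y x) (leviCivitaFun Z x (X x))
  rw [real_inner_comm _ (Y x), h1, h2]
  simp only [koszul]
  rw [mlieBracket_swap_apply (V := Z) (W := Y)]
  simp only [inner_neg_left, real_inner_comm]
  ring

variable (I) in
/-- A smooth vector field on `M`. -/
def IsSmoothField (X : Π x : M, TangentSpace I x) : Prop :=
  ContMDiff I I.tangent ∞ (fun x ↦ (⟨x, X x⟩ : TangentBundle I M))

variable {E' : Type*} [NormedAddCommGroup E'] [NormedSpace ℝ E'] [FiniteDimensional ℝ E']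
  {H' : Type*} [TopologicalSpace H'] {J : ModelWithCorners ℝ E' H'}
  {N : Type*} [TopologicalSpace N] [ChartedSpace H' N] [IsManifold J ∞ N]
  [RiemannianBundle (fun y : N ↦ TangentSpace J y)]
  [IsContMDiffRiemannianBundle J ∞ E' (fun y : N ↦ TangentSpace J y)]

/-- The pullback connection `∇^F` of a connection on `TN`, acting on sections `s` of `F⁻¹TN`:
writing `s = ∑ sⁱ (Eᵢ ∘ F)` in a local frame `Eᵢ` of `TN` around `F p`, one has
`∇^F_u s = ∑ (u(sⁱ) Eᵢ + sⁱ ∇_{F_* u} Eᵢ)`. -/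
def pullbackConnection (cov : CovariantDerivative J E' (fun y : N ↦ TangentSpace J y))
    (F : M → N) (s : Π p : M, TangentSpace J (F p)) (p : M) :
    TangentSpace I p →L[ℝ] TangentSpace J (F p) :=
  letI e := trivializationAt E' (fun y : N ↦ TangentSpace J y) (F p)
  letI b := Module.finBasis ℝ E'
  ∑ i, ((mvfderiv I (fun q ↦ e.localFrameCoeff J b i (F q) (s q)) p).smulRight
      (e.localFrame b i (F p))
    + e.localFrameCoeff J b i (F p) (s p) • (cov (e.localFrame b i) (F p) ∘L mfderiv I J F p))

/-- Along sections of the form `W ∘ F` the pullback connection is `∇^F_u (W ∘ F) = ∇_{F_* u} W`. -/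
theorem pullbackConnection_comp (cov : CovariantDerivative J E' (fun y : N ↦ TangentSpace J y))
    {F : M → N} {p : M} (hF : MDifferentiableAt I J F p) {W : Π y : N, TangentSpace J y}
    (hW : MDiffAt (T% W) (F p)) :
    pullbackConnection (I := I) cov F (fun q ↦ W (F q)) p = cov W (F p) ∘L mfderiv I J F p := by
  set e := trivializationAt E' (fun y : N ↦ TangentSpace J y) (F p) with he
  have hy : F p ∈ e.baseSet := FiberBundle.mem_baseSet_trivializationAt' (F p)
  let b := Module.finBasis ℝ E'
  let c : Fin (Module.finrank ℝ E') → N → ℝ := fun i y ↦ e.localFrameCoeff J b i y (W y)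
  have hc : ∀ i, MDiffAt (c i) (F p) := fun i ↦ mdifferentiableAt_localFrameCoeff b hy hW i
  have hE : ∀ i, MDiffAt (T% (e.localFrame b i)) (F p) := fun i ↦
    (contMDiffAt_localFrame_of_mem 1 e b i hy).mdifferentiableAt one_ne_zero
  have hs : ∀ s : Finset (Fin (Module.finrank ℝ E')),
      MDiffAt (T% (∑ i ∈ s, c i • e.localFrame b i)) (F p) ∧
      cov (∑ i ∈ s, c i • e.localFrame b i) (F p) =
        ∑ i ∈ s, (c i (F p) • cov (e.localFrame b i) (F p)
          + (mvfderiv J (c i) (F p)).smulRight (e.localFrame b i (F p))) := by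
    intro s
    induction s using Finset.induction_on with
    | empty =>
      refine ⟨?_, ?_⟩
      · simpa using! mdifferentiableAt_zeroSection ..
      · simp
    | insert i s hi ih =>
      have h1 := (hc i).smul_section (hE i)
      rw [Finset.sum_insert hi, Finset.sum_insert hi]
      exact ⟨mdifferentiableAt_add_section h1 ih.1, by
        rw [cov.isCovariantDerivativeOnUniv.add h1 ih.1, ih.2,
          cov.isCovariantDerivativeOnUniv.leibniz (hE i) (hc i)]⟩
  have hev : ∀ᶠ y in nhds (F p), W y = (∑ i, c i • e.localFrame b i) y := by
    filter_upwards [e.eventually_eq_localFrame_sum_coeff_smul (I := J) b hy (s := W)] with y h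
    simpa [c] using h
  have hcov : cov W (F p) = ∑ i, (c i (F p) • cov (e.localFrame b i) (F p)
      + (mvfderiv J (c i) (F p)).smulRight (e.localFrame b i (F p))) := by
    rw [← (hs Finset.univ).2]
    exact cov.isCovariantDerivativeOnUniv.congr_of_eventuallyEq hW (hs Finset.univ).1
      Filter.univ_mem hev
  rw [hcov]
  ext u
  simp only [pullbackConnection]
  simp only [ContinuousLinearMap.comp_apply, sum_apply, add_apply,
    ContinuousLinearMap.smulRight_apply, smul_apply]
  refine Finset.sum_congr rfl fun i _ ↦ ?_
  have hd : mvfderiv I (fun q ↦ c i (F q)) p = mvfderiv J (c i) (F p) ∘L mfderiv I J F p :=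
    mvfderiv_comp p (hc i) hF
  change mvfderiv I (fun q ↦ c i (F q)) p u • _ + _ = _
  rw [hd, add_comm]
  rfl

variable (I J) in
/-- The second fundamental form of a map `F : M → N`,
`(∇F_*)(X, Y) = ∇^F_X (F_* Y) - F_* (∇_X Y)`. -/
def secondFundamentalForm (F : M → N) (X Y : Π x : M, TangentSpace I x) (p : M) :
    TangentSpace J (F p) :=
  pullbackConnection (leviCivita J N) F (fun q ↦ mfderiv I J F q (Y q)) p (X p)
    - mfderiv I J F p (leviCivita I M Y p (X p))

variable (I J) in
/-- The vertical space `ker F_*` at `p`. -/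
def verticalSpace (F : M → N) (p : M) : Submodule ℝ (TangentSpace I p) :=
  LinearMap.ker (mfderiv I J F p).toLinearMap

variable (I J) in
/-- The horizontal space `(ker F_*)^⊥` at `p`. -/
def horizontalSpace (F : M → N) (p : M) : Submodule ℝ (TangentSpace I p) :=
  (verticalSpace I J F p)ᗮ

variable (I J) in
/-- The vertical part of a vector field. -/
def ver (F : M → N) (X : Π x : M, TangentSpace I x) (p : M) : TangentSpace I p :=
  (verticalSpace I J F p).starProjection (X p)

variable (I J) in
/-- The horizontal part of a vector field. -/
def hor (F : M → N) (X : Π x : M, TangentSpace I x) (p : M) : TangentSpace I p :=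
  (horizontalSpace I J F p).starProjection (X p)

variable (I J) in
/-- `Γ(ker F_*)`: smooth vertical vector fields. -/
def IsVerticalField (F : M → N) (V : Π x : M, TangentSpace I x) : Prop :=
  IsSmoothField I V ∧ ∀ p, V p ∈ verticalSpace I J F p

variable (I J) in
/-- `Γ((ker F_*)^⊥)`: smooth horizontal vector fields. -/
def IsHorizontalField (F : M → N) (X : Π x : M, TangentSpace I x) : Prop :=
  IsSmoothField I X ∧ ∀ p, X p ∈ horizontalSpace I J F p

variable (I J) in
/-- The horizontal distribution is integrable: it is closed under the Lie bracket. -/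
def HorizontalIntegrable (F : M → N) : Prop :=
  ∀ X Y : Π x : M, TangentSpace I x, IsHorizontalField I J F X → IsHorizontalField I J F Y →
    ∀ p, mlieBracket I X Y p ∈ horizontalSpace I J F p

variable (I J) in
/-- O'Neill's tensor `A_X Y = 𝒱 ∇_{ℋX} (ℋY) + ℋ ∇_{ℋX} (𝒱Y)`. -/
def oneillA (F : M → N) (X Y : Π x : M, TangentSpace I x) : Π x : M, TangentSpace I x :=
  fun p ↦ ver I J F (fun q ↦ leviCivita I M (hor I J F Y) q (hor I J F X q)) p
    + hor I J F (fun q ↦ leviCivita I M (ver I J F Y) q (hor I J F X q)) p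

variable (I J) in
/-- A Riemannian submersion: a smooth map of `M` onto `N`, of maximal rank, whose differential
preserves the lengths of horizontal vectors. -/
structure IsRiemannianSubmersion (F : M → N) : Prop where
  contMDiff : ContMDiff I J ∞ F
  surjective : Function.Surjective F
  surjective_mfderiv : ∀ p, Function.Surjective (mfderiv I J F p)
  norm_mfderiv : ∀ p, ∀ v ∈ horizontalSpace I J F p, ‖mfderiv I J F p v‖ = ‖v‖

variable (I M) in
/-- An almost contact metric structure `(φ, ξ, η, g)` on the Riemannian manifold `(M, g)`. -/
structure AlmostContactMetricStructure where
  /-- the `(1,1)`-tensor field `φ` -/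
  phi : Π p : M, TangentSpace I p →L[ℝ] TangentSpace I p
  /-- the characteristic vector field `ξ` -/
  xi : Π p : M, TangentSpace I p
  /-- the `1`-form `η` -/
  eta : Π p : M, TangentSpace I p →L[ℝ] ℝ
  contMDiff_phi : ContMDiff I (I.prod 𝓘(ℝ, E →L[ℝ] E)) ∞
    (fun p ↦ TotalSpace.mk' (E →L[ℝ] E) (E := fun q : M ↦ TangentSpace I q →L[ℝ] TangentSpace I q)
      p (phi p))
  contMDiff_xi : IsSmoothField I xi
  contMDiff_eta : ContMDiff I (I.prod 𝓘(ℝ, E →L[ℝ] ℝ)) ∞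
    (fun p ↦ TotalSpace.mk' (E →L[ℝ] ℝ)
      (E := fun q : M ↦ TangentSpace I q →L[ℝ] Bundle.Trivial M ℝ q) p (eta p))
  phi_phi : ∀ p v, phi p (phi p v) = -v + eta p v • xi p
  phi_xi : ∀ p, phi p (xi p) = 0
  eta_phi : ∀ p v, eta p (phi p v) = 0
  eta_xi : ∀ p, eta p (xi p) = 1
  inner_phi_phi : ∀ p v w, inner ℝ (phi p v) (phi p w) = inner ℝ v w - eta p v * eta p w
  eta_eq_inner : ∀ p v, eta p v = inner ℝ v (xi p)

variable (I) in
/-- The exterior derivative of a `1`-form `α` on vector fields: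
`X(α(Y)) - Y(α(X)) - α([X, Y])` (under the other usual normalization this is `2 dα(X, Y)`). -/
def extDerivOneForm (α : Π p : M, TangentSpace I p → ℝ) (X Y : Π x : M, TangentSpace I x)
    (p : M) : ℝ :=
  mvfderiv I (fun q ↦ α q (Y q)) p (X p) - mvfderiv I (fun q ↦ α q (X q)) p (Y p)
    - α p (mlieBracket I X Y p)

variable (I) in
/-- The exterior derivative of a `2`-form `α` on vector fields: the cyclic sum of
`X(α(Y, Z)) - α([X, Y], Z)` (under the other usual normalization this is `3 dα(X, Y, Z)`). -/
def extDerivTwoForm (α : Π p : M, TangentSpace I p → TangentSpace I p → ℝ)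
    (X Y Z : Π x : M, TangentSpace I x) (p : M) : ℝ :=
  mvfderiv I (fun q ↦ α q (Y q) (Z q)) p (X p)
    + mvfderiv I (fun q ↦ α q (Z q) (X q)) p (Y p)
    + mvfderiv I (fun q ↦ α q (X q) (Y q)) p (Z p)
    - α p (mlieBracket I X Y p) (Z p)
    - α p (mlieBracket I Y Z p) (X p)
    - α p (mlieBracket I Z X p) (Y p)

variable (I) in
/-- The Nijenhuis tensor `[φ, φ]` of a `(1,1)`-tensor field, on vector fields. -/
def nijenhuis (phi : Π p : M, TangentSpace I p →L[ℝ] TangentSpace I p)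
    (X Y : Π x : M, TangentSpace I x) (p : M) : TangentSpace I p :=
  phi p (phi p (mlieBracket I X Y p))
    + mlieBracket I (fun q ↦ phi q (X q)) (fun q ↦ phi q (Y q)) p
    - phi p (mlieBracket I (fun q ↦ phi q (X q)) Y p)
    - phi p (mlieBracket I X (fun q ↦ phi q (Y q)) p)

namespace AlmostContactMetricStructure

/-- The fundamental `2`-form `Φ(X, Y) = g(X, φY)`. -/
def fundamentalForm (S : AlmostContactMetricStructure I M) (p : M) (v w : TangentSpace I p) : ℝ :=
  inner ℝ v (S.phi p w)

/-- Normality: `[φ, φ] + 2 dη ⊗ ξ = 0`, where `2 dη(X, Y) = X(η(Y)) - Y(η(X)) - η([X, Y])`. -/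
def IsNormal (S : AlmostContactMetricStructure I M) : Prop :=
  ∀ X Y : Π x : M, TangentSpace I x, IsSmoothField I X → IsSmoothField I Y → ∀ p,
    nijenhuis I S.phi X Y p + extDerivOneForm I (fun q v ↦ S.eta q v) X Y p • S.xi p = 0

/-- A cosymplectic structure: a normal almost contact metric structure for which `Φ` and `η` are
closed. -/
structure IsCosymplectic (S : AlmostContactMetricStructure I M) : Prop where
  normal : S.IsNormal
  closed_eta : ∀ X Y : Π x : M, TangentSpace I x, IsSmoothField I X → IsSmoothField I Y →
    ∀ p, extDerivOneForm I (fun q v ↦ S.eta q v) X Y p = 0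
  closed_fundamentalForm : ∀ X Y Z : Π x : M, TangentSpace I x,
    IsSmoothField I X → IsSmoothField I Y → IsSmoothField I Z →
    ∀ p, extDerivTwoForm I S.fundamentalForm X Y Z p = 0

/-- The field `φX`. -/
def phiField (S : AlmostContactMetricStructure I M) (X : Π x : M, TangentSpace I x) :
    Π x : M, TangentSpace I x :=
  fun p ↦ S.phi p (X p)

variable (J) in
/-- `BX`, the vertical component of `φX`. -/
def B (S : AlmostContactMetricStructure I M) (F : M → N) (X : Π x : M, TangentSpace I x) :
    Π x : M, TangentSpace I x :=
  ver I J F (S.phiField X)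

variable (J) in
/-- `CX`, the horizontal component of `φX`. -/
def C (S : AlmostContactMetricStructure I M) (F : M → N) (X : Π x : M, TangentSpace I x) :
    Π x : M, TangentSpace I x :=
  hor I J F (S.phiField X)

variable (J) in
/-- `ker F_*` is anti-invariant: `φ(ker F_*) ⊆ (ker F_*)^⊥`. -/
def IsAntiInvariant (S : AlmostContactMetricStructure I M) (F : M → N) : Prop :=
  ∀ p, ∀ v ∈ verticalSpace I J F p, S.phi p v ∈ horizontalSpace I J F p

variable (J) in
/-- `μ`, the orthogonal complement of `φ(ker F_*)` in `(ker F_*)^⊥`. -/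
def muSpace (S : AlmostContactMetricStructure I M) (F : M → N) (p : M) :
    Submodule ℝ (TangentSpace I p) :=
  horizontalSpace I J F p ⊓ ((verticalSpace I J F p).map (S.phi p).toLinearMap)ᗮ

/-- `φX = BX + CX`. -/
theorem B_add_C (S : AlmostContactMetricStructure I M) (F : M → N)
    (X : Π x : M, TangentSpace I x) (p : M) :
    S.B J F X p + S.C J F X p = S.phi p (X p) := by
  simp [B, C, ver, hor, horizontalSpace, phiField]

/-- If `ξ` is vertical and `ker F_*` is anti-invariant, then `CX` is a section of `μ` for
horizontal `X`, so that `φX = BX + CX` is the decomposition of `φX` along `ker F_* ⊕ μ`. -/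
theorem C_mem_muSpace (S : AlmostContactMetricStructure I M) {F : M → N}
    (hF : S.IsAntiInvariant J F) (hxi : ∀ p, S.xi p ∈ verticalSpace I J F p)
    {X : Π x : M, TangentSpace I x} {p : M} (hX : X p ∈ horizontalSpace I J F p) :
    S.C J F X p ∈ S.muSpace J F p := by
  refine ⟨Submodule.starProjection_apply_mem _ _, ?_⟩
  rintro _ ⟨v, hv, rfl⟩
  have h1 : inner ℝ (S.phi p v) (S.B J F X p) = 0 := by
    rw [real_inner_comm]
    exact hF p v hv _ (Submodule.starProjection_apply_mem _ _)
  have h2 := S.inner_phi_phi p v (X p)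
  have h3 : S.eta p (X p) = 0 := by
    rw [S.eta_eq_inner, real_inner_comm]
    exact hX _ (hxi p)
  rw [← S.B_add_C (J := J) F X p, inner_add_right, h1, h3, hX v hv] at h2
  simp at h2 ⊢
  exact h2

end AlmostContactMetricStructure

end RiemSubm

end

open RiemSubm

/-! Everything rests on one pointwise identity (`inner_mlieBracket`): for horizontal X, Y and
vertical V, g([X,Y],V) equals the left side of (iii) minus its right side.

Closedness of η, together with η = 0 on horizontal vectors (ξ is vertical), gives η([X,Y]) = 0, so
g([X,Y],V) = g(φ[X,Y],φV). Since [X,Y] = ∇_X Y - ∇_Y X, it remains to compute g(φ∇_X Y,φV). On a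
cosymplectic manifold ∇φ = 0 (`inner_covPhi_eq_zero`), so φ∇_X Y = ∇_X BY + ∇_X CY. As φV is
horizontal, the first term contributes g(A_X BY,φV). As CY is orthogonal to φ(ker F_*), the second
contributes -g(CY,∇_X φV) = -g(CY,φ∇_X V) = -g(CY,φA_X V).

Statements (ii) and (iii) agree term by term: F_* kills BY, so (∇F_*)(X,BY) = -F_*(∇_X BY), and F_*
is isometric on horizontal vectors. To recover (i), the identity is tested on the vertical part of
[X,Y], which must be known to be a smooth field; this is the purpose of the smoothness lemmas. -/

namespace RiemSubm

/-! ### Smoothness of vector fields from their inner products -/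

section Smoothness

variable {E : Type*} [NormedAddCommGroup E] [NormedSpace ℝ E] [FiniteDimensional ℝ E]
  {H : Type*} [TopologicalSpace H] {I : ModelWithCorners ℝ E H}
  {M : Type*} [TopologicalSpace M] [ChartedSpace H M]

theorem contMDiffAt_det {ι : Type*} [Fintype ι] [DecidableEq ι] {n : ℕ∞ω}
    {A : M → Matrix ι ι ℝ} {x : M}
    (h : ∀ i j, ContMDiffAt I 𝓘(ℝ) n (fun q ↦ A q i j) x) :
    ContMDiffAt I 𝓘(ℝ) n (fun q ↦ (A q).det) x := by
  simp only [Matrix.det_apply']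
  exact contMDiffAt_finsetSum fun σ _ ↦
    contMDiffAt_const.mul (contMDiffAt_finsetProd fun i _ ↦ h _ _)

variable [IsManifold I ∞ M]
  [RiemannianBundle (fun x : M ↦ TangentSpace I x)]
  [IsContMDiffRiemannianBundle I ∞ E (fun x : M ↦ TangentSpace I x)]

/-- A vector field is smooth at a point if its inner products with the fields that are smooth there
are: its coefficients in a local frame are given by Cramer's rule for the Gram matrix. -/
theorem contMDiffAt_of_inner {Z : Π x : M, TangentSpace I x} {x : M}
    (h : ∀ Y : Π x : M, TangentSpace I x, ContMDiffAt I I.tangent ∞ (T% Y) x →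
      ContMDiffAt I 𝓘(ℝ) ∞ (fun q ↦ inner ℝ (Y q) (Z q)) x) :
    ContMDiffAt I I.tangent ∞ (T% Z) x := by
  classical
  set e := trivializationAt E (fun y : M ↦ TangentSpace I y) x with he
  have hx : x ∈ e.baseSet := FiberBundle.mem_baseSet_trivializationAt' x
  let b := Module.finBasis ℝ E
  have hfr : ∀ i, ContMDiffAt I I.tangent ∞ (T% (e.localFrame b i)) x := fun i ↦
    contMDiffAt_localFrame_of_mem ∞ e b i hx
  let G : M → Matrix (Fin (Module.finrank ℝ E)) (Fin (Module.finrank ℝ E)) ℝ :=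
    fun q ↦ Matrix.gram ℝ fun i ↦ e.localFrame b i q
  let w : M → Fin (Module.finrank ℝ E) → ℝ := fun q i ↦ inner ℝ (e.localFrame b i q) (Z q)
  have hG : ∀ i j, ContMDiffAt I 𝓘(ℝ) ∞ (fun q ↦ G q i j) x := fun i j ↦
    ContMDiffAt.inner_bundle (F := E) (E := fun x : M ↦ TangentSpace I x) (b := id)
      (hfr i) (hfr j)
  -- A Gram matrix is nonsingular exactly when its vectors are linearly independent, which a local
  -- frame is.
  have hdet : ∀ q ∈ e.baseSet, (G q).det ≠ 0 := fun q hq ↦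
    Matrix.det_gram_ne_zero_iff_linearIndependent.2
      ((e.isLocalFrameOn_localFrame_baseSet I ∞ b).linearIndependent hq)
  rw [contMDiffAt_iff_localFrameCoeff (e := e) b hx]
  intro i
  have hsm : ContMDiffAt I 𝓘(ℝ) ∞
      (fun q ↦ ((G q).updateCol i (w q)).det * ((G q).det)⁻¹) x := by
    refine ContMDiffAt.mul (contMDiffAt_det fun k l ↦ ?_)
      ((contMDiffAt_det hG).inv₀ (hdet x hx))
    by_cases hl : l = i
    · subst hl
      simpa [w] using h _ (hfr k)
    · simpa [Matrix.updateCol_ne hl] using hG k l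
  refine hsm.congr_of_eventuallyEq ?_
  filter_upwards [e.open_baseSet.mem_nhds hx] with q hq
  have hZ := e.eq_sum_localFrameCoeff_smul (I := I) (b := b) (s := Z) hq
  -- The coefficients c of Z solve the linear system G c = w; multiplying by the adjugate of G gives
  -- det G • c, which is Cramer's rule.
  have hw : w q = (G q).mulVec (fun j ↦ e.localFrameCoeff I b j q (Z q)) := by
    funext k
    simp only [w]
    conv_lhs => rw [hZ]
    rw [inner_sum]
    simp [Matrix.mulVec, dotProduct, G, Matrix.gram_apply, real_inner_smul_right, mul_comm]
  rw [eq_mul_inv_iff_mul_eq₀ (hdet q hq), ← Matrix.cramer_apply, hw,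
    Matrix.cramer_eq_adjugate_mulVec, Matrix.mulVec_mulVec, Matrix.adjugate_mul,
    Matrix.smul_mulVec, Matrix.one_mulVec]
  simp [mul_comm]

namespace IsSmoothField

variable {X Y : Π x : M, TangentSpace I x}

theorem mdiffAt (hX : IsSmoothField I X) (p : M) : MDiffAt (T% X) p :=
  (hX p).mdifferentiableAt (by simp)

theorem sub (hX : IsSmoothField I X) (hY : IsSmoothField I Y) :
    IsSmoothField I (fun q ↦ X q - Y q) := by
  have h : ContMDiff I I.tangent ∞ (T% (X - Y)) := ContMDiff.sub_section hX hY
  exact h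

theorem mlieBracket (hX : IsSmoothField I X) (hY : IsSmoothField I Y) :
    IsSmoothField I (mlieBracket I X Y) :=
  -- The bracket costs one derivative, which is harmless because ∞ + 1 = ∞.
  haveI : IsManifold I (((⊤ : ℕ∞) : ℕ∞ω) + 1) M := inferInstanceAs (IsManifold I ∞ M)
  haveI : IsManifold I (minSmoothness ℝ 2) M := by
    rw [minSmoothness_of_isRCLikeNormedField]; infer_instance
  fun p ↦ ContMDiffAt.mlieBracket_vectorField (n := ⊤) (m := ⊤) (hX p) (hY p) (by simp)

theorem phiField (S : AlmostContactMetricStructure I M) (hX : IsSmoothField I X) :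
    IsSmoothField I (S.phiField X) :=
  ContMDiff.clm_bundle_apply (b := fun q : M ↦ q) S.contMDiff_phi hX

end IsSmoothField

end Smoothness

/-! ### Vertical and horizontal parts under a Riemannian submersion -/

section Submersion

variable {E : Type*} [NormedAddCommGroup E] [NormedSpace ℝ E] [FiniteDimensional ℝ E]
  {H : Type*} [TopologicalSpace H] {I : ModelWithCorners ℝ E H}
  {M : Type*} [TopologicalSpace M] [ChartedSpace H M] [IsManifold I ∞ M]
  [RiemannianBundle (fun x : M ↦ TangentSpace I x)]
  [IsContMDiffRiemannianBundle I ∞ E (fun x : M ↦ TangentSpace I x)]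
  {E' : Type*} [NormedAddCommGroup E'] [NormedSpace ℝ E'] [FiniteDimensional ℝ E']
  {H' : Type*} [TopologicalSpace H'] {J : ModelWithCorners ℝ E' H'}
  {N : Type*} [TopologicalSpace N] [ChartedSpace H' N] [IsManifold J ∞ N]
  [RiemannianBundle (fun y : N ↦ TangentSpace J y)]
  [IsContMDiffRiemannianBundle J ∞ E' (fun y : N ↦ TangentSpace J y)]
  {F : M → N} {X Y V : Π x : M, TangentSpace I x} {p : M}

theorem ver_mem (F : M → N) (X : Π x : M, TangentSpace I x) (p : M) :
    ver I J F X p ∈ verticalSpace I J F p :=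
  Submodule.starProjection_apply_mem _ _

theorem hor_mem (F : M → N) (X : Π x : M, TangentSpace I x) (p : M) :
    hor I J F X p ∈ horizontalSpace I J F p :=
  Submodule.starProjection_apply_mem _ _

theorem ver_eq_sub_hor (F : M → N) (X : Π x : M, TangentSpace I x) (p : M) :
    ver I J F X p = X p - hor I J F X p := by
  simp [ver, hor, horizontalSpace]

theorem ver_add_hor (F : M → N) (X : Π x : M, TangentSpace I x) (p : M) :
    ver I J F X p + hor I J F X p = X p := by
  simp [ver_eq_sub_hor]

theorem ver_eq_self (h : X p ∈ verticalSpace I J F p) : ver I J F X p = X p :=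
  Submodule.starProjection_eq_self_iff.2 h

theorem hor_eq_self (h : X p ∈ horizontalSpace I J F p) : hor I J F X p = X p :=
  Submodule.starProjection_eq_self_iff.2 h

theorem hor_eq_zero (h : X p ∈ verticalSpace I J F p) : hor I J F X p = 0 := by
  simpa [ver_eq_self h] using ver_add_hor (J := J) F X p

theorem mfderiv_of_mem_verticalSpace {v : TangentSpace I p} (h : v ∈ verticalSpace I J F p) :
    mfderiv I J F p v = 0 := h

theorem inner_of_mem {v w : TangentSpace I p} (hv : v ∈ verticalSpace I J F p)
    (hw : w ∈ horizontalSpace I J F p) : inner ℝ v w = 0 := hw v hv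

theorem mfderiv_hor (F : M → N) (X : Π x : M, TangentSpace I x) (p : M) :
    mfderiv I J F p (hor I J F X p) = mfderiv I J F p (X p) := by
  conv_rhs => rw [← ver_add_hor (J := J) F X p, map_add,
    mfderiv_of_mem_verticalSpace (ver_mem F X p), zero_add]

namespace IsRiemannianSubmersion

/-- Polarization: the sum of two horizontal vectors is horizontal, so preservation of lengths
determines inner products. -/
theorem inner_mfderiv (hF : IsRiemannianSubmersion I J F) {v w : TangentSpace I p}
    (hv : v ∈ horizontalSpace I J F p) (hw : w ∈ horizontalSpace I J F p) :
    inner ℝ (mfderiv I J F p v) (mfderiv I J F p w) = inner ℝ v w := by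
  rw [real_inner_eq_norm_add_mul_self_sub_norm_mul_self_sub_norm_mul_self_div_two,
    real_inner_eq_norm_add_mul_self_sub_norm_mul_self_sub_norm_mul_self_div_two, ← map_add,
    hF.norm_mfderiv p _ hv, hF.norm_mfderiv p _ hw,
    hF.norm_mfderiv p _ (Submodule.add_mem _ hv hw)]

/-- One horizontal argument suffices: the vertical part of the other is killed by F_* and is
orthogonal to w. -/
theorem inner_mfderiv_left (hF : IsRiemannianSubmersion I J F) (v : TangentSpace I p)
    {w : TangentSpace I p} (hw : w ∈ horizontalSpace I J F p) :
    inner ℝ (mfderiv I J F p v) (mfderiv I J F p w) = inner ℝ v w := by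
  have hd : v = (verticalSpace I J F p).starProjection v
      + (verticalSpace I J F p)ᗮ.starProjection v := by simp
  have hm : (verticalSpace I J F p).starProjection v ∈ verticalSpace I J F p :=
    Submodule.starProjection_apply_mem _ _
  rw [hd, map_add, mfderiv_of_mem_verticalSpace hm, zero_add, inner_add_left,
    inner_of_mem hm hw, zero_add]
  exact hF.inner_mfderiv (Submodule.starProjection_apply_mem _ _) hw

/-- The horizontal part of a smooth field is smooth, since
`⟪Y, ℋX⟫ = ⟪F_* Y, F_* X⟫` for all `Y`. -/
theorem isSmoothField_hor (hF : IsRiemannianSubmersion I J F) (hX : IsSmoothField I X) :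
    IsSmoothField I (hor I J F X) := by
  intro p
  refine contMDiffAt_of_inner fun Y hY ↦ ?_
  have hT : ContMDiff I.tangent J.tangent ∞ (tangentMap I J F) :=
    hF.contMDiff.contMDiff_tangentMap (by simp)
  have h1 : ContMDiffAt I J.tangent ∞
      (fun q ↦ (⟨F q, mfderiv I J F q (Y q)⟩ : TangentBundle J N)) p :=
    (hT _).comp p hY
  have h2 : ContMDiffAt I J.tangent ∞
      (fun q ↦ (⟨F q, mfderiv I J F q (X q)⟩ : TangentBundle J N)) p :=
    (hT _).comp p (hX p)
  have h3 := ContMDiffAt.inner_bundle (F := E') (E := fun y : N ↦ TangentSpace J y) (b := F) h1 h2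
  refine h3.congr_of_eventuallyEq (.of_forall fun q ↦ ?_)
  beta_reduce
  rw [← mfderiv_hor F X q, hF.inner_mfderiv_left _ (hor_mem F X q)]

theorem isSmoothField_ver (hF : IsRiemannianSubmersion I J F) (hX : IsSmoothField I X) :
    IsSmoothField I (ver I J F X) := by
  rw [show ver I J F X = fun q ↦ X q - hor I J F X q from funext (ver_eq_sub_hor F X)]
  exact hX.sub (hF.isSmoothField_hor hX)

end IsRiemannianSubmersion

end Submersion

end RiemSubm

namespace RiemSubm

/-! ### Torsion-freeness and metric compatibility in the form used below -/

section LeviCivita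

variable {E : Type*} [NormedAddCommGroup E] [NormedSpace ℝ E] [FiniteDimensional ℝ E]
  {H : Type*} [TopologicalSpace H] {I : ModelWithCorners ℝ E H}
  {M : Type*} [TopologicalSpace M] [ChartedSpace H M] [IsManifold I ∞ M]
  [RiemannianBundle (fun x : M ↦ TangentSpace I x)]
  [IsContMDiffRiemannianBundle I ∞ E (fun x : M ↦ TangentSpace I x)]
  {X Y Z : Π x : M, TangentSpace I x} {p : M}

theorem mlieBracket_eq_leviCivita (hX : MDiffAt (T% X) p) (hY : MDiffAt (T% Y) p) :
    mlieBracket I X Y p = leviCivita I M Y p (X p) - leviCivita I M X p (Y p) :=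
  ((CovariantDerivative.torsion_eq_zero_iff (leviCivita I M)).1 leviCivita_torsion hX hY).symm

/-- Metric compatibility for a pair of orthogonal fields. -/
theorem inner_leviCivita_of_orthogonal (hX : MDiffAt (T% X) p) (hY : MDiffAt (T% Y) p)
    (hZ : MDiffAt (T% Z) p) (h : ∀ q, inner ℝ (Y q) (Z q) = 0) :
    inner ℝ (leviCivita I M Y p (X p)) (Z p) = -inner ℝ (Y p) (leviCivita I M Z p (X p)) := by
  have h1 := leviCivita_metric hX hY hZ
  rw [funext h] at h1
  simp [mvfderiv] at h1
  linarith

end LeviCivita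

/-! ### Parallelism of φ on a cosymplectic manifold -/

namespace AlmostContactMetricStructure

variable {E : Type*} [NormedAddCommGroup E] [NormedSpace ℝ E] [FiniteDimensional ℝ E]
  {H : Type*} [TopologicalSpace H] {I : ModelWithCorners ℝ E H}
  {M : Type*} [TopologicalSpace M] [ChartedSpace H M] [IsManifold I ∞ M]
  [RiemannianBundle (fun x : M ↦ TangentSpace I x)]
  [IsContMDiffRiemannianBundle I ∞ E (fun x : M ↦ TangentSpace I x)]
  (S : AlmostContactMetricStructure I M) {X Y Z : Π x : M, TangentSpace I x} {p : M}

theorem phiField_apply (X : Π x : M, TangentSpace I x) (p : M) :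
    S.phiField X p = S.phi p (X p) := rfl

/-- Apply g(φ·,φ·) = g - η ⊗ η to φv and w; the η terms drop out because η ∘ φ = 0. -/
theorem inner_phi_left (v w : TangentSpace I p) :
    inner ℝ (S.phi p v) w = -inner ℝ v (S.phi p w) := by
  have h1 := S.inner_phi_phi p (S.phi p v) w
  rw [S.phi_phi, S.eta_phi, inner_add_left, inner_neg_left, real_inner_smul_left,
    real_inner_comm, real_inner_comm (S.phi p w) (S.xi p), ← S.eta_eq_inner, S.eta_phi] at h1
  rw [real_inner_comm (S.phi p w) v]
  linarith

/-- `∇_v (φY) - φ (∇_v Y)`, that is `(∇_v φ) Y`. -/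
noncomputable def covPhi (Y : Π x : M, TangentSpace I x) (p : M) :
    TangentSpace I p →L[ℝ] TangentSpace I p :=
  leviCivita I M (S.phiField Y) p - S.phi p ∘L leviCivita I M Y p

theorem covPhi_apply (Y : Π x : M, TangentSpace I x) (p : M) (v : TangentSpace I p) :
    S.covPhi Y p v = leviCivita I M (S.phiField Y) p v - S.phi p (leviCivita I M Y p v) := rfl

/-- The covariant derivative of the skew-symmetry g(φY,Z) = -g(Y,φZ). -/
theorem inner_covPhi_skew (hX : IsSmoothField I X) (hY : IsSmoothField I Y)
    (hZ : IsSmoothField I Z) (p : M) :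
    inner ℝ (S.covPhi Y p (X p)) (Z p) = -inner ℝ (S.covPhi Z p (X p)) (Y p) := by
  have h1 := leviCivita_metric (hX.mdiffAt p) ((hY.phiField S).mdiffAt p) (hZ.mdiffAt p)
  have h2 := leviCivita_metric (hX.mdiffAt p) (hY.mdiffAt p) ((hZ.phiField S).mdiffAt p)
  have hf : (fun q ↦ inner ℝ (S.phiField Y q) (Z q))
      = -fun q ↦ inner ℝ (Y q) (S.phiField Z q) := by
    funext q
    exact S.inner_phi_left _ _
  rw [hf, mvfderiv_neg, neg_apply, h2] at h1
  simp only [covPhi_apply, inner_sub_left]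
  simp only [phiField_apply] at h1
  linarith [S.inner_phi_left (leviCivita I M Y p (X p)) (Z p),
    S.inner_phi_left (leviCivita I M Z p (X p)) (Y p),
    real_inner_comm (S.phi p (Y p)) (leviCivita I M Z p (X p)),
    real_inner_comm (Y p) (leviCivita I M (S.phiField Z) p (X p))]

/-- For a torsion-free connection dΦ is the cyclic sum of ∇Φ, and (∇_X Φ)(Y,Z) = -g((∇_X φ)Y,Z); so
this is dΦ = 0. -/
theorem cyclic_inner_covPhi (hS : S.IsCosymplectic) (hX : IsSmoothField I X)
    (hY : IsSmoothField I Y) (hZ : IsSmoothField I Z) (p : M) :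
    inner ℝ (S.covPhi Y p (X p)) (Z p) + inner ℝ (S.covPhi Z p (Y p)) (X p)
      + inner ℝ (S.covPhi X p (Z p)) (Y p) = 0 := by
  have h := hS.closed_fundamentalForm X Y Z hX hY hZ p
  have h1 := leviCivita_metric (hX.mdiffAt p) (hY.mdiffAt p) ((hZ.phiField S).mdiffAt p)
  have h2 := leviCivita_metric (hY.mdiffAt p) (hZ.mdiffAt p) ((hX.phiField S).mdiffAt p)
  have h3 := leviCivita_metric (hZ.mdiffAt p) (hX.mdiffAt p) ((hY.phiField S).mdiffAt p)
  have k1 := S.inner_covPhi_skew hX hY hZ p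
  have k2 := S.inner_covPhi_skew hY hZ hX p
  have k3 := S.inner_covPhi_skew hZ hX hY p
  simp only [extDerivTwoForm, fundamentalForm] at h
  simp only [phiField_apply] at h1 h2 h3
  rw [h1, h2, h3, mlieBracket_eq_leviCivita (hX.mdiffAt p) (hY.mdiffAt p),
    mlieBracket_eq_leviCivita (hY.mdiffAt p) (hZ.mdiffAt p),
    mlieBracket_eq_leviCivita (hZ.mdiffAt p) (hX.mdiffAt p)] at h
  rw [k1, k2, k3]
  simp only [covPhi_apply, inner_sub_left, S.inner_phi_left] at h ⊢
  linarith [real_inner_comm (Y p) (leviCivita I M (S.phiField Z) p (X p)),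
    real_inner_comm (Z p) (leviCivita I M (S.phiField X) p (Y p)),
    real_inner_comm (X p) (leviCivita I M (S.phiField Y) p (Z p))]

/-- Expanding each bracket by torsion-freeness, the derivatives of X and Y themselves cancel and
only derivatives of φ survive. -/
theorem nijenhuis_eq_covPhi (hX : IsSmoothField I X) (hY : IsSmoothField I Y) (p : M) :
    nijenhuis I S.phi X Y p = S.covPhi Y p (S.phi p (X p)) - S.covPhi X p (S.phi p (Y p))
      + S.phi p (S.covPhi X p (Y p)) - S.phi p (S.covPhi Y p (X p)) := by
  have hX' := (hX.phiField S).mdiffAt p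
  have hY' := (hY.phiField S).mdiffAt p
  change S.phi p (S.phi p (mlieBracket I X Y p))
    + mlieBracket I (S.phiField X) (S.phiField Y) p
    - S.phi p (mlieBracket I (S.phiField X) Y p)
    - S.phi p (mlieBracket I X (S.phiField Y) p) = _
  rw [mlieBracket_eq_leviCivita (hX.mdiffAt p) (hY.mdiffAt p), mlieBracket_eq_leviCivita hX' hY',
    mlieBracket_eq_leviCivita hX' (hY.mdiffAt p), mlieBracket_eq_leviCivita (hX.mdiffAt p) hY']
  simp only [covPhi_apply, map_sub]
  simp only [phiField]
  abel

theorem nijenhuis_eq_zero (hS : S.IsCosymplectic) (hX : IsSmoothField I X)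
    (hY : IsSmoothField I Y) (p : M) : nijenhuis I S.phi X Y p = 0 := by
  simpa [hS.closed_eta X Y hX hY p] using hS.normal X Y hX hY p

theorem mvfderiv_eta (hX : IsSmoothField I X) (hY : IsSmoothField I Y) (p : M) :
    mvfderiv I (fun q ↦ S.eta q (Y q)) p (X p)
      = S.eta p (leviCivita I M Y p (X p)) + inner ℝ (Y p) (leviCivita I M S.xi p (X p)) := by
  simp only [S.eta_eq_inner]
  exact leviCivita_metric (hX.mdiffAt p) (hY.mdiffAt p) (S.contMDiff_xi.mdiffAt p)

/-- The difference of the two sides is X(η(Y)) - Y(η(X)) - η([X,Y]), as η is dual to ξ; hence closed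
η makes ∇ξ self-adjoint. -/
theorem inner_leviCivita_xi_symm (hS : S.IsCosymplectic) (hX : IsSmoothField I X)
    (hY : IsSmoothField I Y) (p : M) :
    inner ℝ (leviCivita I M S.xi p (X p)) (Y p)
      = inner ℝ (leviCivita I M S.xi p (Y p)) (X p) := by
  have h := hS.closed_eta X Y hX hY p
  simp only [extDerivOneForm] at h
  rw [S.mvfderiv_eta hX hY, S.mvfderiv_eta hY hX,
    mlieBracket_eq_leviCivita (hX.mdiffAt p) (hY.mdiffAt p), map_sub,
    real_inner_comm, real_inner_comm _ (X p)] at h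
  linarith

/-- The derivative of `φ² = -1 + η ⊗ ξ`. -/
theorem covPhi_phiField (hX : IsSmoothField I X) (hY : IsSmoothField I Y) (p : M) :
    S.covPhi (S.phiField Y) p (X p) + S.phi p (S.covPhi Y p (X p))
      = inner ℝ (leviCivita I M S.xi p (X p)) (Y p) • S.xi p
        + S.eta p (Y p) • leviCivita I M S.xi p (X p) := by
  have hη : MDiffAt (fun q ↦ S.eta q (Y q)) p := by
    simp only [S.eta_eq_inner]
    exact mdiff_inner (hY.mdiffAt p) (S.contMDiff_xi.mdiffAt p)
  have hξ := S.contMDiff_xi.mdiffAt p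
  -- The scalar -1 is written as a constant function so that the Leibniz rule covers both summands;
  -- its derivative vanishes.
  have hfield : S.phiField (S.phiField Y)
      = (fun _ : M ↦ (-1 : ℝ)) • Y + (fun q ↦ S.eta q (Y q)) • S.xi := by
    funext q
    simp [phiField, S.phi_phi]
  have hc : MDiffAt (fun _ : M ↦ (-1 : ℝ)) p := mdifferentiableAt_const
  have hcov := (leviCivita I M).isCovariantDerivativeOnUniv
  have hd : leviCivita I M (S.phiField (S.phiField Y)) p (X p)
      = -leviCivita I M Y p (X p) + S.eta p (Y p) • leviCivita I M S.xi p (X p)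
        + mvfderiv I (fun q ↦ S.eta q (Y q)) p (X p) • S.xi p := by
    rw [hfield, hcov.add (hc.smul_section (hY.mdiffAt p)) (hη.smul_section hξ),
      hcov.leibniz (hY.mdiffAt p) hc, hcov.leibniz hξ hη]
    simp [mvfderiv, add_assoc]
  rw [covPhi_apply, covPhi_apply, map_sub, S.phi_phi, hd, S.mvfderiv_eta hX hY,
    real_inner_comm (Y p), add_smul]
  abel

/-- On a cosymplectic manifold `φ` is parallel. -/
theorem inner_covPhi_eq_zero (hS : S.IsCosymplectic) (hX : IsSmoothField I X)
    (hY : IsSmoothField I Y) (hZ : IsSmoothField I Z) (p : M) :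
    inner ℝ (S.covPhi Y p (X p)) (Z p) = 0 := by
  have hξ := S.contMDiff_xi
  have hd : ∀ {X Y : Π x : M, TangentSpace I x}, IsSmoothField I X → IsSmoothField I Y →
      ∀ w : TangentSpace I p, inner ℝ (S.covPhi (S.phiField Y) p (X p)) w
        = inner ℝ (S.covPhi Y p (X p)) (S.phi p w)
          + inner ℝ (leviCivita I M S.xi p (X p)) (Y p) * S.eta p w
          + S.eta p (Y p) * inner ℝ (leviCivita I M S.xi p (X p)) w := by
    intro X Y hX hY w
    have h := congrArg (fun v ↦ inner ℝ v w) (S.covPhi_phiField hX hY p)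
    simp only [inner_add_left, real_inner_smul_left, S.inner_phi_left,
      real_inner_comm w (S.xi p), ← S.eta_eq_inner] at h
    linarith
  have hxi : ∀ v w : TangentSpace I p, inner ℝ (S.covPhi S.xi p v) w
      = inner ℝ (leviCivita I M S.xi p v) (S.phi p w) := by
    intro v w
    have h0 : S.phiField S.xi = 0 := funext fun q ↦ S.phi_xi q
    rw [covPhi_apply, h0, (leviCivita I M).isCovariantDerivativeOnUniv.zero, zero_apply, zero_sub,
      inner_neg_left, S.inner_phi_left, neg_neg]
  -- The next two facts say that putting φ on both slots of g((∇_X φ)Y,Z) reverses its sign up to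
  -- terms in η and ∇ξ.
  have hperp : ∀ {X Y : Π x : M, TangentSpace I x}, IsSmoothField I X → IsSmoothField I Y →
      inner ℝ (S.covPhi Y p (X p)) (S.xi p)
        = -inner ℝ (leviCivita I M S.xi p (X p)) (S.phi p (Y p)) := by
    intro X Y hX hY
    rw [S.inner_covPhi_skew hX hY hξ, hxi]
  have hphi2 : ∀ {X Y : Π x : M, TangentSpace I x}, IsSmoothField I X → IsSmoothField I Y →
      ∀ w : TangentSpace I p, inner ℝ (S.covPhi (S.phiField Y) p (X p)) (S.phi p w)
        = -inner ℝ (S.covPhi Y p (X p)) w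
          - S.eta p w * inner ℝ (leviCivita I M S.xi p (X p)) (S.phi p (Y p))
          + S.eta p (Y p) * inner ℝ (leviCivita I M S.xi p (X p)) (S.phi p w) := by
    intro X Y hX hY w
    rw [hd hX hY, S.phi_phi, S.eta_phi, inner_add_right, inner_neg_right, real_inner_smul_right,
      hperp hX hY]
    ring
  -- The classical formula for ∇φ in terms of dΦ and [φ,φ], here with both zero. The cyclic identity
  -- at (X,Y,Z) minus the one at (X,φY,φZ) contains 2g((∇_X φ)Y,Z). The vanishing of [φ,φ](Y,φZ),
  -- paired with X, cancels the other terms, apart from terms in η and ∇ξ.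
  have hmain : ∀ {X Y Z : Π x : M, TangentSpace I x}, IsSmoothField I X → IsSmoothField I Y →
      IsSmoothField I Z → inner ℝ (S.covPhi Y p (X p)) (Z p)
        = -(S.eta p (Z p) * inner ℝ (leviCivita I M S.xi p (X p)) (S.phi p (Y p))) := by
    intro X Y Z hX hY hZ
    have hY' := hY.phiField S
    have hZ' := hZ.phiField S
    have c1 := S.cyclic_inner_covPhi hS hX hY hZ p
    have c2 := S.cyclic_inner_covPhi hS hX hY' hZ' p
    -- Expresses the term in ∇_ξ φ, which enters through φ²Z = -Z + η(Z)ξ, by ∇ξ.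
    have c3 := S.cyclic_inner_covPhi hS hξ hY hX p
    have n1 := congrArg (fun v ↦ inner ℝ v (X p))
      ((S.nijenhuis_eq_covPhi hY hZ' p).symm.trans (S.nijenhuis_eq_zero hS hY hZ' p))
    simp only [inner_add_left, inner_sub_left, S.inner_phi_left, inner_zero_left] at n1
    have e1 := hphi2 hX hY (Z p)
    have e2 := hphi2 hY hZ (X p)
    have e3 := hd hZ' hY (X p)
    have e4 : inner ℝ (S.covPhi Y p (S.phi p (S.phi p (Z p)))) (X p)
        = -inner ℝ (S.covPhi Y p (Z p)) (X p)
          + S.eta p (Z p) * inner ℝ (S.covPhi Y p (S.xi p)) (X p) := by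
      rw [S.phi_phi, map_add, map_neg, map_smul, inner_add_left, inner_neg_left,
        real_inner_smul_left]
    have s1 := S.inner_leviCivita_xi_symm hS hX hZ' p
    have s2 := S.inner_leviCivita_xi_symm hS hY hZ' p
    have k1 := S.inner_covPhi_skew hZ hY hX p
    have k2 := S.inner_covPhi_skew hZ' hY' hX p
    have k3 := hxi (X p) (Y p)
    have k4 := hperp hY hX
    simp only [phiField_apply] at *
    rw [show inner ℝ (S.covPhi Y p (S.xi p)) (X p)
        = inner ℝ (leviCivita I M S.xi p (Y p)) (S.phi p (X p))
          - inner ℝ (leviCivita I M S.xi p (X p)) (S.phi p (Y p)) by linarith] at e4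
    -- The symmetry of ∇ξ is needed with factors η(Y) and η(X); `linarith` cannot form these
    -- products itself.
    have s1' := congrArg (S.eta p (Y p) * ·) s1
    have s2' := congrArg (S.eta p (X p) * ·) s2
    linarith
  -- At Y = ξ the right side vanishes because φξ = 0, while (∇_X φ)ξ = -φ∇_X ξ. Hence g(∇_X ξ,φY) =
  -- 0, which removes the only remaining term.
  have h0 := hmain hX hξ hY
  rw [hxi, S.phi_xi, inner_zero_right, mul_zero, neg_zero] at h0
  rw [hmain hX hY hZ, h0, mul_zero, neg_zero]

end AlmostContactMetricStructure

end RiemSubm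

/-! ### O'Neill's tensor, the second fundamental form and the bracket identity -/

namespace RiemSubm

variable {E : Type*} [NormedAddCommGroup E] [NormedSpace ℝ E] [FiniteDimensional ℝ E]
  {H : Type*} [TopologicalSpace H] {I : ModelWithCorners ℝ E H}
  {M : Type*} [TopologicalSpace M] [ChartedSpace H M] [IsManifold I ∞ M]
  [RiemannianBundle (fun x : M ↦ TangentSpace I x)]
  [IsContMDiffRiemannianBundle I ∞ E (fun x : M ↦ TangentSpace I x)]
  {E' : Type*} [NormedAddCommGroup E'] [NormedSpace ℝ E'] [FiniteDimensional ℝ E']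
  {H' : Type*} [TopologicalSpace H'] {J : ModelWithCorners ℝ E' H'}
  {N : Type*} [TopologicalSpace N] [ChartedSpace H' N] [IsManifold J ∞ N]
  [RiemannianBundle (fun y : N ↦ TangentSpace J y)]
  [IsContMDiffRiemannianBundle J ∞ E' (fun y : N ↦ TangentSpace J y)]
  {F : M → N} {X Y V : Π x : M, TangentSpace I x}

theorem oneillA_of_horizontal_of_vertical (hX : ∀ q, X q ∈ horizontalSpace I J F q)
    (hV : ∀ q, V q ∈ verticalSpace I J F q) (p : M) :
    oneillA I J F X V p = hor I J F (fun q ↦ leviCivita I M V q (X q)) p := by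
  have h1 : hor I J F V = 0 := funext fun q ↦ hor_eq_zero (hV q)
  have h2 : ver I J F V = V := funext fun q ↦ ver_eq_self (hV q)
  have h3 : hor I J F X = X := funext fun q ↦ hor_eq_self (hX q)
  have h4 : ∀ q, leviCivita I M (0 : Π x : M, TangentSpace I x) q = 0 := fun q ↦
    (leviCivita I M).isCovariantDerivativeOnUniv.zero
  rw [oneillA, h1, h2, h3]
  simp [h4, ver]

theorem inner_oneillA_of_horizontal (hX : ∀ q, X q ∈ horizontalSpace I J F q)
    (hV : ∀ q, V q ∈ verticalSpace I J F q) {p : M} {w : TangentSpace I p}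
    (hw : w ∈ horizontalSpace I J F p) :
    inner ℝ (oneillA I J F X V p) w = inner ℝ (leviCivita I M V p (X p)) w := by
  rw [oneillA_of_horizontal_of_vertical hX hV,
    ← ver_add_hor (J := J) F (fun q ↦ leviCivita I M V q (X q)) p, inner_add_left,
    inner_of_mem (ver_mem F _ p) hw, zero_add]

/-- F_*V is the zero section of the pullback bundle, so its frame coefficients, and with them the
pullback derivative, vanish. -/
theorem secondFundamentalForm_of_vertical (Y : Π x : M, TangentSpace I x)
    (hV : ∀ q, V q ∈ verticalSpace I J F q) (p : M) :
    secondFundamentalForm I J F Y V p = -mfderiv I J F p (leviCivita I M V p (Y p)) := by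
  have h0 : (fun q ↦ mfderiv I J F q (V q)) = fun _ ↦ 0 :=
    funext fun q ↦ mfderiv_of_mem_verticalSpace (hV q)
  have h1 : ∀ i q, (trivializationAt E' (fun y : N ↦ TangentSpace J y) (F p)).localFrameCoeff J
      (Module.finBasis ℝ E') i (F q) 0 = 0 := fun i q ↦ map_zero _
  rw [secondFundamentalForm, h0]
  simp only [pullbackConnection, h1]
  simp [mvfderiv]

/-- The dictionary between (ii) and (iii), used with w = φV, which is horizontal by anti-invariance.
-/
theorem IsRiemannianSubmersion.inner_secondFundamentalForm (hF : IsRiemannianSubmersion I J F)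
    (hY : ∀ q, Y q ∈ horizontalSpace I J F q) (hV : ∀ q, V q ∈ verticalSpace I J F q) {p : M}
    {w : TangentSpace I p} (hw : w ∈ horizontalSpace I J F p) :
    inner ℝ (secondFundamentalForm I J F Y V p) (mfderiv I J F p w)
      = -inner ℝ (oneillA I J F Y V p) w := by
  rw [secondFundamentalForm_of_vertical Y hV, inner_neg_left, hF.inner_mfderiv_left _ hw,
    inner_oneillA_of_horizontal hY hV hw]

/-- The horizontal distribution is integrable as soon as brackets of horizontal fields are
orthogonal to the smooth vertical fields. -/
theorem IsRiemannianSubmersion.horizontalIntegrable_iff (hF : IsRiemannianSubmersion I J F) :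
    HorizontalIntegrable I J F ↔ ∀ X Y V : Π x : M, TangentSpace I x,
      IsHorizontalField I J F X → IsHorizontalField I J F Y → IsVerticalField I J F V →
      ∀ p, inner ℝ (mlieBracket I X Y p) (V p) = 0 := by
  constructor
  · intro h X Y V hX hY hV p
    rw [real_inner_comm]
    exact inner_of_mem (hV.2 p) (h X Y hX hY p)
  · intro h X Y hX hY p
    -- Testing on the vertical part of the bracket itself yields its squared length.
    have h1 := h X Y (ver I J F (mlieBracket I X Y)) hX hY
      ⟨hF.isSmoothField_ver (hX.1.mlieBracket hY.1), ver_mem F _⟩ p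
    have h2 : ver I J F (mlieBracket I X Y) p = 0 := by
      rw [← ver_add_hor (J := J) F (mlieBracket I X Y) p, inner_add_left,
        real_inner_comm _ (hor I J F _ p), inner_of_mem (ver_mem F _ p) (hor_mem F _ p),
        add_zero, inner_self_eq_zero] at h1
      exact h1
    rw [← ver_add_hor (J := J) F (mlieBracket I X Y) p, h2, zero_add]
    exact hor_mem F _ p

namespace AlmostContactMetricStructure

variable (S : AlmostContactMetricStructure I M)

theorem B_mem (F : M → N) (X : Π x : M, TangentSpace I x) (p : M) :
    S.B J F X p ∈ verticalSpace I J F p := ver_mem F _ p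

theorem eta_of_horizontal (hxi : ∀ p, S.xi p ∈ verticalSpace I J F p) {p : M}
    {v : TangentSpace I p} (hv : v ∈ horizontalSpace I J F p) : S.eta p v = 0 := by
  rw [S.eta_eq_inner, real_inner_comm]
  exact inner_of_mem (hxi p) hv

theorem inner_C_phi (hanti : S.IsAntiInvariant J F) (hxi : ∀ p, S.xi p ∈ verticalSpace I J F p)
    {p : M} (hX : X p ∈ horizontalSpace I J F p) {v : TangentSpace I p}
    (hv : v ∈ verticalSpace I J F p) : inner ℝ (S.C J F X p) (S.phi p v) = 0 := by
  rw [real_inner_comm]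
  exact (S.C_mem_muSpace hanti hxi hX).2 _ ⟨v, hv, rfl⟩

/-- Since `η` is closed and vanishes on horizontal fields, it vanishes on their brackets. -/
theorem eta_mlieBracket_of_horizontal (hS : S.IsCosymplectic)
    (hxi : ∀ p, S.xi p ∈ verticalSpace I J F p)
    (hX : IsHorizontalField I J F X) (hY : IsHorizontalField I J F Y) (p : M) :
    S.eta p (mlieBracket I X Y p) = 0 := by
  have h := hS.closed_eta X Y hX.1 hY.1 p
  simp only [extDerivOneForm, S.eta_of_horizontal hxi (hX.2 _),
    S.eta_of_horizontal hxi (hY.2 _)] at h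
  simpa [mvfderiv] using h

theorem inner_phi_leviCivita (hS : S.IsCosymplectic) (hF : IsRiemannianSubmersion I J F)
    (hanti : S.IsAntiInvariant J F) (hxi : ∀ p, S.xi p ∈ verticalSpace I J F p)
    (hX : IsHorizontalField I J F X) (hY : IsHorizontalField I J F Y)
    (hV : IsVerticalField I J F V) (p : M) :
    inner ℝ (S.phi p (leviCivita I M Y p (X p))) (S.phi p (V p))
      = inner ℝ (oneillA I J F X (S.B J F Y) p) (S.phi p (V p))
        - inner ℝ (S.C J F Y p) (S.phi p (oneillA I J F X V p)) := by
  have hφV := hV.1.phiField S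
  have hB : IsSmoothField I (S.B J F Y) := hF.isSmoothField_ver (hY.1.phiField S)
  have hC : IsSmoothField I (S.C J F Y) := hF.isSmoothField_hor (hY.1.phiField S)
  -- Parallelism of φ is used twice: to pass from φ∇_X Y to ∇_X φY, and from ∇_X φV to φ∇_X V.
  have h1 := S.inner_covPhi_eq_zero hS hX.1 hY.1 hφV p
  have h2 := S.inner_covPhi_eq_zero hS hX.1 hV.1 hC p
  have hadd : S.phiField Y = S.B J F Y + S.C J F Y :=
    funext fun q ↦ (S.B_add_C (J := J) F Y q).symm
  -- Differentiating g(CY,φV) = 0 moves the derivative from CY to φV.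
  have h3 := inner_leviCivita_of_orthogonal (hX.1.mdiffAt p) (hC.mdiffAt p) (hφV.mdiffAt p)
    fun q ↦ S.inner_C_phi hanti hxi (hY.2 q) (hV.2 q)
  -- The vertical part of ∇_X V is carried by φ into φ(ker F_*), to which CY is orthogonal; the
  -- horizontal part is A_X V.
  have h4 : inner ℝ (S.C J F Y p) (S.phi p (leviCivita I M V p (X p)))
      = inner ℝ (S.C J F Y p) (S.phi p (oneillA I J F X V p)) := by
    rw [oneillA_of_horizontal_of_vertical hX.2 hV.2,
      ← ver_add_hor (J := J) F (fun q ↦ leviCivita I M V q (X q)) p, map_add, inner_add_right,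
      S.inner_C_phi hanti hxi (hY.2 p) (ver_mem F _ p), zero_add]
  rw [covPhi_apply, hadd,
    (leviCivita I M).isCovariantDerivativeOnUniv.add (hB.mdiffAt p) (hC.mdiffAt p),
    add_apply, inner_sub_left, inner_add_left, h3] at h1
  rw [covPhi_apply, inner_sub_left, real_inner_comm,
    real_inner_comm _ (S.phi p (leviCivita I M V p (X p))), h4] at h2
  rw [inner_oneillA_of_horizontal hX.2 (S.B_mem F Y) (hanti p _ (hV.2 p))]
  simp only [phiField_apply] at h1
  linarith

theorem inner_mlieBracket (hS : S.IsCosymplectic) (hF : IsRiemannianSubmersion I J F)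
    (hanti : S.IsAntiInvariant J F) (hxi : ∀ p, S.xi p ∈ verticalSpace I J F p)
    (hX : IsHorizontalField I J F X) (hY : IsHorizontalField I J F Y)
    (hV : IsVerticalField I J F V) (p : M) :
    inner ℝ (mlieBracket I X Y p) (V p)
      = inner ℝ (oneillA I J F X (S.B J F Y) p - oneillA I J F Y (S.B J F X) p) (S.phi p (V p))
        - (inner ℝ (S.C J F Y p) (S.phi p (oneillA I J F X V p))
          - inner ℝ (S.C J F X p) (S.phi p (oneillA I J F Y V p))) := by
  have h1 := S.inner_phi_leviCivita hS hF hanti hxi hX hY hV p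
  have h2 := S.inner_phi_leviCivita hS hF hanti hxi hY hX hV p
  have h3 := S.inner_phi_phi p (mlieBracket I X Y p) (V p)
  rw [S.eta_mlieBracket_of_horizontal hS hxi hX hY, zero_mul, sub_zero] at h3
  rw [← h3, mlieBracket_eq_leviCivita (hX.1.mdiffAt p) (hY.1.mdiffAt p), map_sub, inner_sub_left,
    inner_sub_left, h1, h2]
  ring

end AlmostContactMetricStructure

end RiemSubm

/-! ### The equivalences -/

theorem theorem3
    {E : Type*} [NormedAddCommGroup E] [NormedSpace ℝ E] [FiniteDimensional ℝ E]
    {M : Type*} [TopologicalSpace M] [ChartedSpace E M] [IsManifold 𝓘(ℝ, E) ∞ M] [T2Space M]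
    [RiemannianBundle (fun x : M ↦ TangentSpace 𝓘(ℝ, E) x)]
    [IsContMDiffRiemannianBundle 𝓘(ℝ, E) ∞ E (fun x : M ↦ TangentSpace 𝓘(ℝ, E) x)]
    {E' : Type*} [NormedAddCommGroup E'] [NormedSpace ℝ E'] [FiniteDimensional ℝ E']
    {N : Type*} [TopologicalSpace N] [ChartedSpace E' N] [IsManifold 𝓘(ℝ, E') ∞ N] [T2Space N]
    [RiemannianBundle (fun y : N ↦ TangentSpace 𝓘(ℝ, E') y)]
    [IsContMDiffRiemannianBundle 𝓘(ℝ, E') ∞ E' (fun y : N ↦ TangentSpace 𝓘(ℝ, E') y)]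
    (S : AlmostContactMetricStructure 𝓘(ℝ, E) M) (hS : S.IsCosymplectic)
    (F : M → N) (hF : IsRiemannianSubmersion 𝓘(ℝ, E) 𝓘(ℝ, E') F)
    (hanti : S.IsAntiInvariant 𝓘(ℝ, E') F)
    (hxi : ∀ p, S.xi p ∈ verticalSpace 𝓘(ℝ, E) 𝓘(ℝ, E') F p) :
    List.TFAE [
      HorizontalIntegrable 𝓘(ℝ, E) 𝓘(ℝ, E') F,
      ∀ X Y V : Π x : M, TangentSpace 𝓘(ℝ, E) x,
        IsHorizontalField 𝓘(ℝ, E) 𝓘(ℝ, E') F X → IsHorizontalField 𝓘(ℝ, E) 𝓘(ℝ, E') F Y →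
        IsVerticalField 𝓘(ℝ, E) 𝓘(ℝ, E') F V → ∀ p : M,
        inner ℝ (secondFundamentalForm 𝓘(ℝ, E) 𝓘(ℝ, E') F Y (S.B 𝓘(ℝ, E') F X) p)
            (mfderiv 𝓘(ℝ, E) 𝓘(ℝ, E') F p (S.phi p (V p)))
          = inner ℝ (secondFundamentalForm 𝓘(ℝ, E) 𝓘(ℝ, E') F X (S.B 𝓘(ℝ, E') F Y) p)
              (mfderiv 𝓘(ℝ, E) 𝓘(ℝ, E') F p (S.phi p (V p)))
            + inner ℝ (S.C 𝓘(ℝ, E') F Y p)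
                (S.phi p (oneillA 𝓘(ℝ, E) 𝓘(ℝ, E') F X V p))
            - inner ℝ (S.C 𝓘(ℝ, E') F X p)
                (S.phi p (oneillA 𝓘(ℝ, E) 𝓘(ℝ, E') F Y V p)),
      ∀ X Y V : Π x : M, TangentSpace 𝓘(ℝ, E) x,
        IsHorizontalField 𝓘(ℝ, E) 𝓘(ℝ, E') F X → IsHorizontalField 𝓘(ℝ, E) 𝓘(ℝ, E') F Y →
        IsVerticalField 𝓘(ℝ, E) 𝓘(ℝ, E') F V → ∀ p : M,
        inner ℝ (oneillA 𝓘(ℝ, E) 𝓘(ℝ, E') F X (S.B 𝓘(ℝ, E') F Y) p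
              - oneillA 𝓘(ℝ, E) 𝓘(ℝ, E') F Y (S.B 𝓘(ℝ, E') F X) p)
            (S.phi p (V p))
          = inner ℝ (S.C 𝓘(ℝ, E') F Y p)
                (S.phi p (oneillA 𝓘(ℝ, E) 𝓘(ℝ, E') F X V p))
            - inner ℝ (S.C 𝓘(ℝ, E') F X p)
                (S.phi p (oneillA 𝓘(ℝ, E) 𝓘(ℝ, E') F Y V p))] := by
  tfae_have 3 ↔ 2 := by
    refine forall₃_congr fun X Y V ↦ forall₃_congr fun hX hY hV ↦ forall_congr' fun p ↦ ?_
    have hw := hanti p _ (hV.2 p)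
    rw [hF.inner_secondFundamentalForm hY.2 (S.B_mem F X) hw,
      hF.inner_secondFundamentalForm hX.2 (S.B_mem F Y) hw, inner_sub_left]
    constructor <;> intro h <;> linarith
  tfae_have 1 ↔ 3 := by
    rw [hF.horizontalIntegrable_iff]
    refine forall₃_congr fun X Y V ↦ forall₃_congr fun hX hY hV ↦ forall_congr' fun p ↦ ?_
    rw [S.inner_mlieBracket hS hF hanti hxi hX hY hV, sub_eq_zero]
  tfae_finish
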